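/- Call a subset of a topological space $\mathbf{\Sigma}^0_2$ if it is the union of a sequence of closed sets. A map $f\colon X\to Y$ between topological spaces is called $\mathbf{\Sigma}^0_2$-measurable if $f^{-1}(U)$ is a $\mathbf{\Sigma}^0_2$ subset of $X$ for every open $U\subset Y$, and piecewise continuous if $X$ can be covered by a sequence $X_0,X_1,\ldots$ of closed sets such that each restriction $f\restriction X_n$ is continuous. A space is completely Baire if each of its closed subspaces is a Baire space, and zero-dimensional if it is a nonempty $T_1$ space with a base of clopen sets. Let $X$ be a metrizable completely Baire space and $Y$ a regular space. If $f\colon X\to Y$ is $\mathbf{\Sigma}^0_2$-measurable and not piecewise continuous, then there is a closed set $K\subset X$ which, as a subspace of $X$, is zero-dimensional and separable, and such that the restriction $f\restriction K\colon K\to Y$ is $\mathbf{\Sigma}^0_2$-measurable and not piecewise continuous. -/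

import Mathlib

open Set TopologicalSpace

/-- `s` is a `Σ⁰₂` subset (an `F_σ` set): a union of a sequence of closed sets. -/
def IsSigmaTwo {X : Type*} [TopologicalSpace X] (s : Set X) : Prop :=
  ∃ F : ℕ → Set X, (∀ n, IsClosed (F n)) ∧ s = ⋃ n, F n

/-- `f` is `Σ⁰₂`-measurable: preimages of open sets are `Σ⁰₂` sets. -/
def SigmaTwoMeasurable {X Y : Type*} [TopologicalSpace X] [TopologicalSpace Y]
    (f : X → Y) : Prop :=
  ∀ U : Set Y, IsOpen U → IsSigmaTwo (f ⁻¹' U)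

/-- `f` is piecewise continuous: its domain is covered by a sequence of closed sets, on each of
which the restriction of `f` is continuous. -/
def PiecewiseContinuous {X Y : Type*} [TopologicalSpace X] [TopologicalSpace Y]
    (f : X → Y) : Prop :=
  ∃ F : ℕ → Set X, (∀ n, IsClosed (F n)) ∧ (⋃ n, F n) = univ ∧ ∀ n, ContinuousOn f (F n)

/-- `X` is completely Baire: every closed subspace of `X` is a Baire space. -/
def CompletelyBaire (X : Type*) [TopologicalSpace X] : Prop :=
  ∀ F : Set X, IsClosed F → BaireSpace F

/-- `X` is zero-dimensional: a nonempty `T₁` space with a base of clopen sets. -/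
def ZeroDimensional (X : Type*) [TopologicalSpace X] : Prop :=
  Nonempty X ∧ T1Space X ∧ IsTopologicalBasis {s : Set X | IsClopen s}

/-! Deleting from a closed non-σ-continuous set all its relatively open σ-continuous pieces leaves a
nonempty closed kernel, because σ-continuity is local in a metric space. As `Y` is regular, the
kernel has a point `x` such that, arbitrarily near `x`, `f` avoids the closure of a fixed
neighbourhood of `f x` on a non-σ-continuous set. Measurability makes that set `F_σ`, so it contains
a closed non-σ-continuous set and the argument repeats inside it. Iterating yields a tree of closed
sets, the children of each converging to its point. `K` is the closure of these countably many
points. It is zero-dimensional because the tree sets are clopen in it. It is Baire, and `f`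
restricted to it is discontinuous at every tree point, so Baire category excludes piecewise
continuity. -/

/-- `A` is covered by countably many closed sets on each of which `f` is continuous. -/
def SigmaContinuousOn {X Y : Type*} [TopologicalSpace X] [TopologicalSpace Y]
    (f : X → Y) (A : Set X) : Prop :=
  ∃ F : ℕ → Set X, (∀ n, IsClosed (F n)) ∧ A ⊆ ⋃ n, F n ∧ ∀ n, ContinuousOn f (F n)

/-! ### σ-continuity and oscillation -/

section Topological

variable {X Y : Type*} [TopologicalSpace X] [TopologicalSpace Y] {f : X → Y} {A B : Set X}

theorem SigmaContinuousOn.mono (h : SigmaContinuousOn f B) (hAB : A ⊆ B) :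
    SigmaContinuousOn f A := by
  obtain ⟨F, hF, hB, hc⟩ := h
  exact ⟨F, hF, hAB.trans hB, hc⟩

theorem SigmaContinuousOn.iUnion {A : ℕ → Set X} (h : ∀ n, SigmaContinuousOn f (A n)) :
    SigmaContinuousOn f (⋃ n, A n) := by
  choose F hF hA hc using h
  refine ⟨fun k => F k.unpair.1 k.unpair.2, fun k => hF _ _, ?_, fun k => hc _ _⟩
  refine iUnion_subset fun n x hx => ?_
  obtain ⟨m, hm⟩ := mem_iUnion.1 (hA n hx)
  exact mem_iUnion.2 ⟨Nat.pair n m, by simpa using hm⟩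

theorem SigmaContinuousOn.union (hA : SigmaContinuousOn f A) (hB : SigmaContinuousOn f B) :
    SigmaContinuousOn f (A ∪ B) := by
  have h : ∀ n : ℕ, SigmaContinuousOn f (if n = 0 then A else B) := fun n => by
    split_ifs
    exacts [hA, hB]
  refine (SigmaContinuousOn.iUnion h).mono (union_subset ?_ ?_)
  · exact subset_iUnion_of_subset 0 (by simp)
  · exact subset_iUnion_of_subset 1 (by simp)

theorem sigmaContinuousOn_of_continuousOn (hA : IsClosed A) (h : ContinuousOn f A) :
    SigmaContinuousOn f A :=
  ⟨fun _ => A, fun _ => hA, subset_iUnion_of_subset 0 subset_rfl, fun _ => h⟩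

theorem piecewiseContinuous_of_sigmaContinuousOn_univ (h : SigmaContinuousOn f univ) :
    PiecewiseContinuous f := by
  obtain ⟨F, hF, hU, hc⟩ := h
  exact ⟨F, hF, univ_subset_iff.1 hU, hc⟩

theorem IsClosed.isSigmaTwo (h : IsClosed A) : IsSigmaTwo A :=
  ⟨fun _ => A, fun _ => h, (iUnion_const A).symm⟩

theorem IsSigmaTwo.inter (hA : IsSigmaTwo A) (hB : IsSigmaTwo B) : IsSigmaTwo (A ∩ B) := by
  obtain ⟨F, hF, rfl⟩ := hA
  obtain ⟨G, hG, rfl⟩ := hB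
  refine ⟨fun k => F k.unpair.1 ∩ G k.unpair.2, fun k => (hF _).inter (hG _), ?_⟩
  ext x
  simp only [mem_inter_iff, mem_iUnion]
  constructor
  · rintro ⟨⟨n, hn⟩, m, hm⟩
    exact ⟨Nat.pair n m, by simpa using ⟨hn, hm⟩⟩
  · rintro ⟨k, hk⟩
    exact ⟨⟨_, hk.1⟩, _, hk.2⟩

theorem SigmaTwoMeasurable.domRestrict (hf : SigmaTwoMeasurable f) (K : Set X) :
    SigmaTwoMeasurable (K.domRestrict f) := by
  intro U hU
  obtain ⟨F, hF, h⟩ := hf U hU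
  refine ⟨fun n => ((↑) : K → X) ⁻¹' F n, fun n => (hF n).preimage continuous_subtype_val, ?_⟩
  rw [← preimage_iUnion, ← h]
  rfl

/-- A Baire space on which the discontinuity points of `f` are dense does not split into
countably many closed pieces of continuity. -/
theorem not_piecewiseContinuous_of_dense [BaireSpace X] [Nonempty X]
    (h : Dense {x | ¬ ContinuousAt f x}) : ¬ PiecewiseContinuous f := by
  rintro ⟨F, hF, hU, hc⟩
  obtain ⟨n, hn⟩ := nonempty_interior_of_iUnion_of_closed hF hU
  obtain ⟨x, hx, hxF⟩ := h.exists_mem_open isOpen_interior hn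
  exact hx ((hc n).continuousAt (mem_interior_iff_mem_nhds.1 hxF))

/-- If the closed set `B` has no nonempty relatively open subset that is σ-continuous for `f`, then
at some point `f` has a neighbourhood of its value that is left on non-σ-continuous sets
arbitrarily close to the point. -/
theorem exists_persistent_oscillation [RegularSpace Y] (hB : IsClosed B) (hne : B.Nonempty)
    (h : ∀ V, IsOpen V → (V ∩ B).Nonempty → ¬ SigmaContinuousOn f (V ∩ B)) :
    ∃ x ∈ B, ∃ W, IsOpen W ∧ f x ∈ W ∧
      ∀ V, IsOpen V → x ∈ V → ¬ SigmaContinuousOn f (V ∩ B ∩ f ⁻¹' (closure W)ᶜ) := by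
  by_contra! hcon
  have hcont : ContinuousOn f B := by
    intro x hx
    refine tendsto_nhdsWithin_iff_subtype hx f _ |>.2 ?_
    rw [Filter.tendsto_def]
    intro S hS
    obtain ⟨C, hC, hCc, hCS⟩ := exists_mem_nhds_isClosed_subset hS
    obtain ⟨V, hV, hxV, hVI⟩ := hcon x hx (interior C) isOpen_interior
      (mem_interior_iff_mem_nhds.2 hC)
    refine Filter.mem_of_superset ((hV.preimage continuous_subtype_val).mem_nhds hxV) ?_
    rintro ⟨z, hz⟩ hzV
    refine hCS ?_
    -- Were `f z` outside `C`, some closed neighbourhood `C'` of it would miss `C`. Every value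
    -- avoids `C` or `C'`, so `V ∩ V' ∩ B` would split into two σ-continuous parts.
    by_contra hzC
    obtain ⟨C', hC', hCc', hCS'⟩ := exists_mem_nhds_isClosed_subset
      (hCc.isOpen_compl.mem_nhds hzC)
    obtain ⟨V', hV', hzV', hVI'⟩ := hcon z hz (interior C') isOpen_interior
      (mem_interior_iff_mem_nhds.2 hC')
    refine h (V ∩ V') (hV.inter hV') ⟨z, ⟨hzV, hzV'⟩, hz⟩ ((hVI.union hVI').mono ?_)
    rintro y ⟨⟨hyV, hyV'⟩, hyB⟩
    by_cases hy : f y ∈ closure (interior C)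
    · refine Or.inr ⟨⟨hyV', hyB⟩, fun hy' => ?_⟩
      exact hCS' (closure_minimal interior_subset hCc' hy')
        (closure_minimal interior_subset hCc hy)
    · exact Or.inl ⟨⟨hyV, hyB⟩, hy⟩
  refine h univ isOpen_univ (by simpa using hne) ?_
  simpa using sigmaContinuousOn_of_continuousOn hB hcont

/-- A closed set with a point at which `f` oscillates, by the neighbourhood `nhd` of its value,
on non-σ-continuous sets. -/
structure OscillationNode (f : X → Y) where
  carrier : Set X
  pt : X
  nhd : Set Y
  isClosed_carrier : IsClosed carrier
  pt_mem : pt ∈ carrier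
  isOpen_nhd : IsOpen nhd
  apply_pt_mem : f pt ∈ nhd
  not_sigmaContinuousOn : ∀ V, IsOpen V → pt ∈ V →
    ¬ SigmaContinuousOn f (V ∩ carrier ∩ f ⁻¹' (closure nhd)ᶜ)

end Topological

/-! ### Localization and splitting in metric spaces -/

section Metric

open Metric

variable {X Y : Type*} [MetricSpace X] [TopologicalSpace Y] {f : X → Y} {A B : Set X}

/-- In a metric space, σ-continuity is a local property. -/
theorem sigmaContinuousOn_sUnion_inter (𝒱 : Set (Set X)) (hopen : ∀ V ∈ 𝒱, IsOpen V)
    (h : ∀ V ∈ 𝒱, SigmaContinuousOn f (V ∩ B)) : SigmaContinuousOn f (⋃₀ 𝒱 ∩ B) := by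
  choose F hF hA hc using fun V : 𝒱 => h V V.2
  let r : 𝒱 → 𝒱 → Prop := WellOrderingRel
  have wf : WellFounded r := IsWellFounded.wf
  -- Stone's trick: `V` is the least member containing `x`, with margin `1 / (n + 1)`. For fixed `n`
  -- these closed sets are uniformly separated, hence locally finite.
  let E : ℕ → 𝒱 → Set X := fun n V =>
    {x | ball x (1 / ((n : ℝ) + 1)) ⊆ V} ∩ {x | ∀ U, r U V → x ∉ (U : Set X)}
  have hpos : ∀ n : ℕ, 0 < 1 / ((n : ℝ) + 1) := fun n => Nat.one_div_pos_of_nat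
  have hE : ∀ n V, IsClosed (E n V) := by
    intro n V
    refine IsClosed.inter ?_ ?_
    · have : {x | ball x (1 / ((n : ℝ) + 1)) ⊆ (V : Set X)} =
          (⋃ y ∈ (V : Set X)ᶜ, ball y (1 / ((n : ℝ) + 1)))ᶜ := by
        ext x
        simp only [mem_ofPred_eq, mem_compl_iff, mem_iUnion, not_exists, subset_def]
        exact ⟨fun H y hy hxy => hy (H y (mem_ball_comm.1 hxy)),
          fun H y hxy => by_contra fun hy => H y hy (mem_ball_comm.1 hxy)⟩
      rw [this]
      exact (isOpen_biUnion fun _ _ => isOpen_ball).isClosed_compl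
    · simp only [ofPred_forall]
      exact isClosed_iInter fun U => isClosed_iInter fun _ => (hopen U U.2).isClosed_compl
  have hsep : ∀ n U V, U ≠ V → ∀ x ∈ E n U, ∀ y ∈ E n V, 1 / ((n : ℝ) + 1) ≤ dist x y := by
    intro n U V hUV x hx y hy
    by_contra! hlt
    rcases trichotomous_of r U V with hr | hr | hr
    · exact hy.2 U hr (hx.1 (mem_ball'.2 hlt))
    · exact hUV hr
    · exact hx.2 V hr (hy.1 (mem_ball.2 hlt))
  have hlf : ∀ n m, LocallyFinite fun V => E n V ∩ F V m := by
    intro n m x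
    refine ⟨ball x (1 / ((n : ℝ) + 1) / 2), ball_mem_nhds _ (half_pos (hpos n)), ?_⟩
    refine Set.Subsingleton.finite ?_
    rintro U ⟨y, hyU, hy⟩ V ⟨z, hzV, hz⟩
    by_contra hUV
    have h1 := hsep n U V hUV y hyU.1 z hzV.1
    have h2 := dist_triangle_right y z x
    rw [mem_ball] at hy hz
    linarith
  have hcl : ∀ n m V, IsClosed (E n V ∩ F V m) := fun n m V => (hE n V).inter (hF V m)
  refine (SigmaContinuousOn.iUnion fun n => SigmaContinuousOn.iUnion fun m =>
    sigmaContinuousOn_of_continuousOn ((hlf n m).isClosed_iUnion (hcl n m))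
      ((hlf n m).continuousOn_iUnion (hcl n m)
        fun V => (hc V m).mono inter_subset_right)).mono ?_
  rintro x ⟨⟨V₀, hV₀, hxV₀⟩, hxB⟩
  obtain ⟨V, hxV, hmin⟩ := wf.has_min {V : 𝒱 | x ∈ (V : Set X)} ⟨⟨V₀, hV₀⟩, hxV₀⟩
  obtain ⟨ε, hε, hball⟩ := Metric.isOpen_iff.1 (hopen V V.2) x hxV
  obtain ⟨n, hn⟩ := exists_nat_one_div_lt hε
  obtain ⟨m, hm⟩ := mem_iUnion.1 (hA V ⟨hxV, hxB⟩)
  simp only [mem_iUnion]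
  exact ⟨n, m, V, ⟨(ball_subset_ball hn.le).trans hball, fun U hU hxU => hmin U hxU hU⟩, hm⟩

/-- The kernel of a closed non-σ-continuous set: what remains after removing all relatively open
σ-continuous subsets. -/
theorem exists_nowhere_sigmaContinuousOn (hB : IsClosed B) (h : ¬ SigmaContinuousOn f B) :
    ∃ C ⊆ B, IsClosed C ∧ C.Nonempty ∧
      ∀ V, IsOpen V → (V ∩ C).Nonempty → ¬ SigmaContinuousOn f (V ∩ C) := by
  let 𝒱 : Set (Set X) := {V | IsOpen V ∧ SigmaContinuousOn f (V ∩ B)}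
  have hU : SigmaContinuousOn f (⋃₀ 𝒱 ∩ B) :=
    sigmaContinuousOn_sUnion_inter 𝒱 (fun V hV => hV.1) fun V hV => hV.2
  refine ⟨B \ ⋃₀ 𝒱, sdiff_subset, hB.sdiff (isOpen_sUnion fun V hV => hV.1), ?_, ?_⟩
  · rw [nonempty_iff_ne_empty, Ne, sdiff_eq_empty]
    exact fun hsub => h (hU.mono fun x hx => ⟨hsub hx, hx⟩)
  · rintro V hV ⟨x, hxV, -, hx⟩ hI
    refine hx ⟨V, ⟨hV, (hI.union hU).mono ?_⟩, hxV⟩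
    rintro y ⟨hyV, hyB⟩
    by_cases hy : y ∈ ⋃₀ 𝒱
    · exact Or.inr ⟨hy, hyB⟩
    · exact Or.inl ⟨hyV, hyB, hy⟩

theorem IsSigmaTwo.exists_oscillationNode [RegularSpace Y] (hA : IsSigmaTwo A)
    (h : ¬ SigmaContinuousOn f A) : ∃ N : OscillationNode f, N.carrier ⊆ A := by
  obtain ⟨F, hF, rfl⟩ := hA
  have : ∃ n, ¬ SigmaContinuousOn f (F n) := by
    by_contra! hcon
    exact h (SigmaContinuousOn.iUnion hcon)
  obtain ⟨n, hn⟩ := this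
  obtain ⟨C, hCF, hC, hne, hV⟩ := exists_nowhere_sigmaContinuousOn (hF n) hn
  obtain ⟨x, hx, W, hW, hxW, hnot⟩ := exists_persistent_oscillation hC hne hV
  exact ⟨⟨C, x, W, hC, hx, hW, hxW, hnot⟩, hCF.trans (subset_iUnion F n)⟩

namespace OscillationNode

theorem exists_child [RegularSpace Y] (hf : SigmaTwoMeasurable f) (N : OscillationNode f)
    {ε : ℝ} (hε : 0 < ε) :
    ∃ M : OscillationNode f, M.carrier ⊆ ball N.pt ε ∩ N.carrier ∩ f ⁻¹' (closure N.nhd)ᶜ := by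
  refine IsSigmaTwo.exists_oscillationNode (IsSigmaTwo.inter (IsSigmaTwo.inter ?_ ?_) ?_)
    (N.not_sigmaContinuousOn _ isOpen_ball (mem_ball_self hε))
  · obtain ⟨F, hF, -, hU, -⟩ := (isOpen_ball (x := N.pt) (ε := ε)).exists_iUnion_isClosed
    exact ⟨F, hF, hU.symm⟩
  · exact N.isClosed_carrier.isSigmaTwo
  · exact hf _ isClosed_closure.isOpen_compl

/-- Every node has a sequence of children converging to its point, with carriers that are
separated from each other by open sets. -/
theorem exists_children [RegularSpace Y] (hf : SigmaTwoMeasurable f) (N : OscillationNode f)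
    {δ : ℝ} (hδ : 0 < δ) :
    ∃ M : ℕ → OscillationNode f,
      (∀ n, (M n).carrier ⊆ ball N.pt δ ∩ N.carrier ∩ f ⁻¹' (closure N.nhd)ᶜ) ∧
      (∀ ε > 0, ∃ m, ∀ n ≥ m, (M n).carrier ⊆ ball N.pt ε) ∧
      ∀ n, ∃ O, IsOpen O ∧ (M n).carrier ⊆ O ∧ N.pt ∉ O ∧
        ∀ m ≠ n, Disjoint (M m).carrier O := by
  -- The dummy value `N` for `ε ≤ 0` lets the radii be defined before they are known to be positive.
  have hch : ∀ ε : ℝ, ∃ M : OscillationNode f, 0 < ε →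
      M.carrier ⊆ ball N.pt ε ∩ N.carrier ∩ f ⁻¹' (closure N.nhd)ᶜ := fun ε => by
    by_cases hε : 0 < ε
    · obtain ⟨M, hM⟩ := N.exists_child hf hε
      exact ⟨M, fun _ => hM⟩
    · exact ⟨N, fun h => absurd h hε⟩
  choose c hc using hch
  -- Each radius is at most half the distance from `N.pt` to the child just chosen, so later
  -- children stay clear of it.
  let e : ℕ → ℝ := fun n =>
    Nat.rec δ (fun _ a => min (a / 2) (infDist N.pt (c a).carrier / 2)) n
  have he : ∀ n, e (n + 1) = min (e n / 2) (infDist N.pt (c (e n)).carrier / 2) := fun _ => rfl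
  have hinf : ∀ a, 0 < a → 0 < infDist N.pt (c a).carrier := fun a ha => by
    refine ((c a).isClosed_carrier.notMem_iff_infDist_pos ⟨_, (c a).pt_mem⟩).1 fun hmem => ?_
    exact (hc a ha hmem).2 (subset_closure N.apply_pt_mem)
  have hpos : ∀ n, 0 < e n := fun n => by
    induction n with
    | zero => exact hδ
    | succ n ih =>
      rw [he]
      exact lt_min (half_pos ih) (half_pos (hinf _ ih))
  have hhalf : ∀ n, e (n + 1) ≤ e n / 2 := fun n => (he n).le.trans (min_le_left _ _)
  have hanti : Antitone e :=
    antitone_nat_of_succ_le fun n => (hhalf n).trans (half_le_self (hpos n).le)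
  have hgeom : ∀ n, e n ≤ δ * (1 / 2) ^ n := fun n => by
    induction n with
    | zero => simp [e]
    | succ n ih =>
      rw [pow_succ]
      linarith [hhalf n]
  have hsub : ∀ n, (c (e n)).carrier ⊆ ball N.pt (e n) := fun n x hx => (hc _ (hpos n) hx).1.1
  have hfar : ∀ n, ∀ x ∈ (c (e n)).carrier, e (n + 1) < dist x N.pt := fun n x hx => by
    have h1 := infDist_le_dist_of_mem (x := N.pt) hx
    have h2 := (he n).le.trans (min_le_right _ _)
    have h3 := hinf _ (hpos n)
    rw [dist_comm]
    linarith
  refine ⟨fun n => c (e n), fun n x hx => ?_, fun ε hε => ?_, fun n => ?_⟩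
  · have hx' := hc _ (hpos n) hx
    exact ⟨⟨ball_subset_ball (hanti n.zero_le) hx'.1.1, hx'.1.2⟩, hx'.2⟩
  · have hlim : Filter.Tendsto (fun n : ℕ => δ * (1 / 2 : ℝ) ^ n) Filter.atTop (nhds (δ * 0)) :=
      (tendsto_pow_atTop_nhds_zero_of_lt_one (by norm_num) (by norm_num)).const_mul δ
    rw [mul_zero] at hlim
    obtain ⟨m, hm⟩ := Filter.eventually_atTop.1 (hlim.eventually (gt_mem_nhds hε))
    exact ⟨m, fun n hn => (hsub n).trans (ball_subset_ball ((hgeom n).trans (hm n hn).le))⟩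
  -- The closed ball absorbs `N.pt` and all later children; the finite union removes the earlier
  -- ones.
  · refine ⟨(closedBall N.pt (e (n + 1)) ∪ ⋃ m ∈ Finset.range n, (c (e m)).carrier)ᶜ,
      (isClosed_closedBall.union (isClosed_biUnion_finset
        fun m _ => (c (e m)).isClosed_carrier)).isOpen_compl, ?_, ?_, ?_⟩
    · intro x hx hx'
      rcases hx' with hx' | hx'
      · exact (hfar n x hx).not_ge hx'
      · simp only [mem_iUnion, Finset.mem_range] at hx'
        obtain ⟨m, hmn, hxm⟩ := hx'
        exact (hfar m x hxm).not_ge ((mem_ball.1 (hsub n hx)).le.trans (hanti hmn))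
    · exact fun h => h (Or.inl (mem_closedBall_self (hpos (n + 1)).le))
    · intro m hmn
      rw [disjoint_compl_right_iff_subset]
      rcases hmn.lt_or_gt with hlt | hlt
      · refine subset_union_of_subset_right ?_ _
        exact subset_biUnion_of_mem (u := fun m => (c (e m)).carrier)
          (Finset.mem_coe.2 (Finset.mem_range.2 hlt))
      · exact subset_union_of_subset_left (((hsub m).trans ball_subset_closedBall).trans
          (closedBall_subset_closedBall (hanti hlt))) _

end OscillationNode

/-! ### Converging trees and the closure of their points -/

/-- A tree of closed sets `B s` with points `x s ∈ B s`, in which the children of each set are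
separated and converge to the point of that set. -/
structure IsConvergingTree (B : List ℕ → Set X) (x : List ℕ → X) : Prop where
  isClosed : ∀ s, IsClosed (B s)
  mem : ∀ s, x s ∈ B s
  subset : ∀ n s, B (n :: s) ⊆ B s
  small : ∀ n s, B (n :: s) ⊆ ball (x s) ((1 / 2) ^ s.length)
  converge : ∀ s, ∀ ε > 0, ∃ m, ∀ n ≥ m, B (n :: s) ⊆ ball (x s) ε
  separated : ∀ s n, ∃ O, IsOpen O ∧ B (n :: s) ⊆ O ∧ x s ∉ O ∧
    ∀ m ≠ n, Disjoint (B (m :: s)) O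

namespace IsConvergingTree

variable {B : List ℕ → Set X} {x : List ℕ → X}

theorem subset_of_suffix (h : IsConvergingTree B x) {s t : List ℕ} (hst : s <:+ t) :
    B t ⊆ B s := by
  obtain ⟨l, rfl⟩ := hst
  induction l with
  | nil => exact subset_rfl
  | cons n l ih => exact (h.subset n (l ++ s)).trans ih

theorem eq_or_cons_suffix {s t : List ℕ} (hst : s <:+ t) : t = s ∨ ∃ n, n :: s <:+ t := by
  obtain ⟨l, rfl⟩ := hst
  rcases List.eq_nil_or_concat l with rfl | ⟨l, n, rfl⟩
  · exact Or.inl rfl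
  · exact Or.inr ⟨n, l, by simp⟩

/-- This is what makes `B s` relatively open in the closure of the tree points. Addresses grow at
the head, so descendants of `s` are the lists with suffix `s`. -/
theorem exists_isOpen (h : IsConvergingTree B x) (s : List ℕ) :
    ∃ O, IsOpen O ∧ B s ⊆ O ∧ ∀ t, x t ∈ O → s <:+ t := by
  induction s with
  | nil => exact ⟨univ, isOpen_univ, subset_univ _, fun t _ => List.nil_suffix⟩
  | cons n s ih =>
    obtain ⟨O, hO, hBO, hOs⟩ := ih
    obtain ⟨P, hP, hBP, hxP, hdisj⟩ := h.separated s n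
    refine ⟨O ∩ P, hO.inter hP, subset_inter ((h.subset n s).trans hBO) hBP, ?_⟩
    rintro t ⟨htO, htP⟩
    rcases eq_or_cons_suffix (hOs t htO) with rfl | ⟨m, hm⟩
    · exact absurd htP hxP
    · by_cases hmn : m = n
      · exact hmn ▸ hm
      · exact absurd htP ((hdisj m hmn).notMem_of_mem_left (h.subset_of_suffix hm (h.mem t)))

theorem isClosed_insert (h : IsConvergingTree B x) (s : List ℕ) :
    IsClosed (insert (x s) (⋃ n, B (n :: s))) := by
  refine isClosed_of_closure_subset fun y hy => ?_
  by_cases hyx : y = x s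
  · exact Or.inl hyx
  have hd := dist_pos.2 hyx
  obtain ⟨m, hm⟩ := h.converge s _ (half_pos hd)
  have hcl : IsClosed (closedBall (x s) (dist y (x s) / 2) ∪
      ⋃ n ∈ Finset.range m, B (n :: s)) :=
    isClosed_closedBall.union (isClosed_biUnion_finset fun n _ => h.isClosed (n :: s))
  have hsub : insert (x s) (⋃ n, B (n :: s)) ⊆ closedBall (x s) (dist y (x s) / 2) ∪
      ⋃ n ∈ Finset.range m, B (n :: s) := by
    refine insert_subset (Or.inl (mem_closedBall_self (half_pos hd).le))
      (iUnion_subset fun n => ?_)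
    rcases lt_or_ge n m with hn | hn
    · exact subset_union_of_subset_right (subset_biUnion_of_mem (u := fun n => B (n :: s))
        (Finset.mem_coe.2 (Finset.mem_range.2 hn))) _
    · exact subset_union_of_subset_left ((hm n hn).trans ball_subset_closedBall) _
  rcases closure_minimal hsub hcl hy with hy' | hy'
  · rw [mem_closedBall] at hy'
    linarith
  · simp only [mem_iUnion] at hy'
    obtain ⟨n, -, hn⟩ := hy'
    exact Or.inr (mem_iUnion.2 ⟨n, hn⟩)

theorem isClopen_preimage (h : IsConvergingTree B x) (s : List ℕ) :
    IsClopen (((↑) : closure (range x) → X) ⁻¹' B s) := by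
  refine ⟨(h.isClosed s).preimage continuous_subtype_val, ?_⟩
  obtain ⟨O, hO, hBO, hOs⟩ := h.exists_isOpen s
  convert hO.preimage continuous_subtype_val using 1
  refine Subset.antisymm (preimage_mono hBO) ?_
  rintro ⟨y, hy⟩ hyO
  refine closure_minimal ?_ (h.isClosed s) (hO.inter_closure ⟨hyO, hy⟩)
  rintro _ ⟨hzO, t, rfl⟩
  exact h.subset_of_suffix (hOs t hzO) (h.mem t)

theorem eq_or_mem_child (h : IsConvergingTree B x) {s : List ℕ} {y : X}
    (hy : y ∈ closure (range x)) (hys : y ∈ B s) : y = x s ∨ ∃ n, y ∈ B (n :: s) := by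
  obtain ⟨O, hO, hBO, hOs⟩ := h.exists_isOpen s
  rw [← mem_iUnion (s := fun n => B (n :: s))]
  refine closure_minimal ?_ (h.isClosed_insert s) (hO.inter_closure ⟨hBO hys, hy⟩)
  rintro _ ⟨hzO, t, rfl⟩
  rcases eq_or_cons_suffix (hOs t hzO) with rfl | ⟨n, hn⟩
  · exact Or.inl rfl
  · exact Or.inr (mem_iUnion.2 ⟨n, h.subset_of_suffix hn (h.mem t)⟩)

theorem notMem_child (h : IsConvergingTree B x) (n : ℕ) (s : List ℕ) : x s ∉ B (n :: s) := by
  obtain ⟨O, -, hBO, hxO, -⟩ := h.separated s n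
  exact fun hx => hxO (hBO hx)

theorem closure_subset (h : IsConvergingTree B x) : closure (range x) ⊆ B [] := by
  refine closure_minimal ?_ (h.isClosed [])
  rintro _ ⟨t, rfl⟩
  exact h.subset_of_suffix List.nil_suffix (h.mem t)

/-- At a tree point `x s`, remove from `B s` the finitely many children that are not small. Any
other point lies on an infinite branch, whose sets shrink. -/
theorem exists_isClopen_subset_ball (h : IsConvergingTree B x) (y : closure (range x))
    {ε : ℝ} (hε : 0 < ε) :
    ∃ V : Set (closure (range x)), IsClopen V ∧ y ∈ V ∧ ∀ z ∈ V, dist (z : X) y < ε := by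
  obtain ⟨y, hy⟩ := y
  by_cases hyx : ∃ s, y = x s
  · obtain ⟨s, rfl⟩ := hyx
    obtain ⟨m, hm⟩ := h.converge s ε hε
    refine ⟨((↑) : closure (range x) → X) ⁻¹' B s \
      ⋃ n ∈ Finset.range m, ((↑) : closure (range x) → X) ⁻¹' B (n :: s),
      (h.isClopen_preimage s).diff (isClopen_biUnion_finset fun n _ => h.isClopen_preimage _),
      ⟨h.mem s, ?_⟩, ?_⟩
    · simp [h.notMem_child]
    · rintro ⟨z, hz⟩ ⟨hzs, hzm⟩
      simp only [mem_iUnion, not_exists, Finset.mem_range] at hzm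
      rcases h.eq_or_mem_child hz hzs with rfl | ⟨n, hn⟩
      · simpa using hε
      · exact hm n (not_lt.1 fun hlt => hzm n hlt hn) hn
  · have hbranch : ∀ k : ℕ, ∃ s : List ℕ, s.length = k ∧ y ∈ B s := fun k => by
      induction k with
      | zero => exact ⟨[], rfl, h.closure_subset hy⟩
      | succ k ih =>
        obtain ⟨s, rfl, hs⟩ := ih
        rcases h.eq_or_mem_child hy hs with hyx' | ⟨n, hn⟩
        · exact absurd ⟨s, hyx'⟩ hyx
        · exact ⟨n :: s, rfl, hn⟩
    obtain ⟨k, hk⟩ := exists_pow_lt_of_lt_one (half_pos hε) (by norm_num : (1 / 2 : ℝ) < 1)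
    obtain ⟨s, rfl, hs⟩ := hbranch k
    rcases h.eq_or_mem_child hy hs with hyx' | ⟨n, hn⟩
    · exact absurd ⟨s, hyx'⟩ hyx
    refine ⟨_, h.isClopen_preimage (n :: s), hn, fun z hz => ?_⟩
    have h1 := mem_ball.1 (h.small n s hn)
    have h2 := mem_ball.1 (h.small n s hz)
    have h3 := dist_triangle_right (z : X) y (x s)
    change dist (z : X) y < ε
    linarith

theorem zeroDimensional_closure (h : IsConvergingTree B x) :
    ZeroDimensional (closure (range x)) := by
  refine ⟨⟨⟨x [], subset_closure (mem_range_self _)⟩⟩, inferInstance, ?_⟩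
  refine isTopologicalBasis_of_isOpen_of_nhds (fun V hV => hV.2) fun y U hyU hU => ?_
  obtain ⟨ε, hε, hball⟩ := Metric.isOpen_iff.1 hU y hyU
  obtain ⟨V, hV, hyV, hVball⟩ := h.exists_isClopen_subset_ball y hε
  exact ⟨V, hV, hyV, fun z hz => hball (hVball z hz)⟩

/-- If `f` maps the children of every `B s` outside a fixed neighbourhood of `f (x s)`, then the
points `x s` witness that `f` is discontinuous on a dense subset of their closure. -/
theorem dense_not_continuousAt (h : IsConvergingTree B x)
    (hosc : ∀ s, ∃ W, IsOpen W ∧ f (x s) ∈ W ∧ ∀ n, ∀ z ∈ B (n :: s), f z ∉ W) :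
    Dense {y | ¬ ContinuousAt ((closure (range x)).domRestrict f) y} := by
  have hdense : Dense {y : closure (range x) | (y : X) ∈ range x} := by
    intro y
    rw [closure_subtype]
    convert y.2
    ext z
    constructor
    · rintro ⟨w, hw, rfl⟩
      exact hw
    · exact fun hz => ⟨⟨z, subset_closure hz⟩, hz, rfl⟩
  refine hdense.mono ?_
  rintro ⟨_, hy⟩ ⟨s, rfl⟩ hcont
  obtain ⟨W, hW, hxW, hout⟩ := hosc s
  obtain ⟨ε, hε, hball⟩ := Metric.mem_nhds_iff.1 (hcont.preimage_mem_nhds (hW.mem_nhds hxW))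
  obtain ⟨m, hm⟩ := h.converge s ε hε
  exact hout m _ (h.mem (m :: s)) (hball
    (show (⟨x (m :: s), subset_closure (mem_range_self _)⟩ : closure (range x)) ∈ _ from
      hm m le_rfl (h.mem (m :: s))))

end IsConvergingTree

/-! ### Building the tree and concluding -/

theorem exists_convergingTree [RegularSpace Y] (hf : SigmaTwoMeasurable f)
    (hfp : ¬ PiecewiseContinuous f) :
    ∃ (B : List ℕ → Set X) (x : List ℕ → X), IsConvergingTree B x ∧
      ∀ s, ∃ W, IsOpen W ∧ f (x s) ∈ W ∧ ∀ n, ∀ z ∈ B (n :: s), f z ∉ W := by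
  obtain ⟨root, -⟩ := (isClosed_univ (X := X)).isSigmaTwo.exists_oscillationNode (f := f)
    fun h => hfp (piecewiseContinuous_of_sigmaContinuousOn_univ h)
  choose M hsub hconv hsep using fun (N : OscillationNode f) (k : ℕ) =>
    N.exists_children hf (pow_pos (one_half_pos (α := ℝ)) k)
  let T : List ℕ → OscillationNode f := fun s =>
    List.rec root (fun n s N => M N s.length n) s
  have hT : ∀ n s, T (n :: s) = M (T s) s.length n := fun _ _ => rfl
  refine ⟨fun s => (T s).carrier, fun s => (T s).pt, ?_, fun s => ?_⟩
  · exact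
      { isClosed := fun s => (T s).isClosed_carrier
        mem := fun s => (T s).pt_mem
        subset := fun n s z hz => (hsub (T s) s.length n hz).1.2
        small := fun n s z hz => (hsub (T s) s.length n hz).1.1
        converge := fun s => hconv (T s) s.length
        separated := fun s => hsep (T s) s.length }
  · exact ⟨(T s).nhd, (T s).isOpen_nhd, (T s).apply_pt_mem, fun n z hz hzW =>
      (hsub (T s) s.length n hz).2 (subset_closure hzW)⟩

end Metric

theorem theorem8 {X : Type*} {Y : Type*} [TopologicalSpace X] [MetrizableSpace X]
    [TopologicalSpace Y] [RegularSpace Y] (hX : CompletelyBaire X) (f : X → Y)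
    (hf : SigmaTwoMeasurable f) (hfp : ¬ PiecewiseContinuous f) :
    ∃ K : Set X, IsClosed K ∧ ZeroDimensional K ∧ SeparableSpace K ∧
      SigmaTwoMeasurable (K.domRestrict f) ∧ ¬ PiecewiseContinuous (K.domRestrict f) := by
  let _ := metrizableSpaceMetric X
  obtain ⟨B, x, h, hosc⟩ := exists_convergingTree hf hfp
  refine ⟨closure (range x), isClosed_closure, h.zeroDimensional_closure,
    (countable_range x).isSeparable.closure.separableSpace, hf.domRestrict _, ?_⟩
  have := hX _ (isClosed_closure (s := range x))
  have : Nonempty (closure (range x)) := h.zeroDimensional_closure.1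
  exact not_piecewiseContinuous_of_dense (h.dense_not_continuousAt hosc)
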